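/- Let $\mathcal X,\mathcal Y$ be finite alphabets and let $p_{XY}$ be a probability distribution on $\mathcal X\times\mathcal Y$ with $p_X(x)>0$ for all $x\in\mathcal X$ and $p_Y(y)>0$ for all $y\in\mathcal Y$. Call $p_{XY}$ $\mathcal X$-confusable if for every $x_1,x_2\in\mathcal X$ there is $y\in\mathcal Y$ with $p_{XY}(x_1,y)>0$ and $p_{XY}(x_2,y)>0$. Let $(X_1,Y_1),\dots,(X_n,Y_n)$ be i.i.d. with distribution $p_{XY}$. A code of blocklength $n$ with a local decoder consists of two encoders mapping $X^n$ and $Y^n$ separately to binary codewords of fixed lengths $k_1$ and $k_2$, and, for each $i\in\{1,\dots,n\}$, a fixed set $\mathcal I_i$ of components of the two codewords together with an estimate $(\hat X_i,\hat Y_i)$ that is a function of these components only. Put $$d_{\mathrm{wc}}=\max_{1\le i\le n}|\mathcal I_i|,\qquad P_e^{(\mathrm{loc})}=\max_{1\le i\le n}\Pr[(\hat X_i,\hat Y_i)\ne(X_i,Y_i)].$$ A rate pair $(R_1,R_2)$ is achievable with strong locality if for every $\varepsilon>0$ there is a sequence of such codes, one for each $n$, with $k_1\le n(R_1+\varepsilon)$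 and $k_2\le n(R_2+\varepsilon)$ for all large $n$, and with $P_e^{(\mathrm{loc})}=o(1)$ and $d_{\mathrm{wc}}=\Theta(1)$ as $n\to\infty$ (the constants may depend on $\varepsilon$). Theorem. If $p_{XY}$ is not $\mathcal X$-confusable, then there is $R_1<H(X)$ such that $(R_1,H(Y))$ is achievable with strong locality, where $H$ denotes Shannon entropy in bits. -/

import Mathlib

open Filter Topology Asymptotics

noncomputable section

/-- Shannon entropy, in bits, of a distribution on a finite alphabet. -/
def shannonEntropy {α : Type*} [Fintype α] (p : PMF α) : ℝ :=
  ∑ a, Real.negMulLog (p a).toReal / Real.log 2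

/-- Probability of the event `E` when the `n` coordinates are i.i.d. with distribution `p`. -/
def iidProb {α : Type*} [Fintype α] (p : PMF α) (n : ℕ) (E : Set (Fin n → α)) : ℝ :=
  ∑ s : Fin n → α, E.indicator (fun s => ∏ j, (p (s j)).toReal) s

/-- Any two letters of the first alphabet are jointly possible with a common letter of the
second alphabet. -/
def XConfusable {X Y : Type*} (p : PMF (X × Y)) : Prop :=
  ∀ x₁ x₂ : X, ∃ y : Y, 0 < p (x₁, y) ∧ 0 < p (x₂, y)

/-- A fixed-length distributed code of blocklength `n` with a nonadaptive local decoder: the two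
source sequences are encoded separately into binary codewords, and the decoder of the `i`-th pair
of symbols sees only the codeword components in the fixed sets `probe₁ i` and `probe₂ i`. -/
structure LocalCode (X Y : Type*) (n : ℕ) where
  /-- length of the first codeword -/
  len₁ : ℕ
  /-- length of the second codeword -/
  len₂ : ℕ
  /-- encoder of the first source -/
  enc₁ : (Fin n → X) → Fin len₁ → Bool
  /-- encoder of the second source -/
  enc₂ : (Fin n → Y) → Fin len₂ → Bool
  /-- components of the first codeword that are probed -/
  probe₁ : Fin n → Finset (Fin len₁)
  /-- components of the second codeword that are probed -/
  probe₂ : Fin n → Finset (Fin len₂)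
  /-- local decoder -/
  dec : (i : Fin n) → (probe₁ i → Bool) → (probe₂ i → Bool) → X × Y

namespace LocalCode

variable {X Y : Type*} {n : ℕ}

/-- The worst-case number of probed codeword components. -/
def locality (c : LocalCode X Y n) : ℕ :=
  Finset.univ.sup fun i => (c.probe₁ i).card + (c.probe₂ i).card

/-- The estimate of the `i`-th pair of symbols when the source sequence is `s`. -/
def estimate (c : LocalCode X Y n) (i : Fin n) (s : Fin n → X × Y) : X × Y :=
  c.dec i (fun j => c.enc₁ (fun t => (s t).1) j) (fun j => c.enc₂ (fun t => (s t).2) j)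

/-- The worst-case (over the position) error probability of the local decoder. -/
def localError [Fintype X] [Fintype Y] (p : PMF (X × Y)) (c : LocalCode X Y n) : ℝ :=
  ⨆ i : Fin n, iidProb p n {s | c.estimate i s ≠ s i}

end LocalCode

/-- The rate pair `(R₁, R₂)` is achievable with strong locality. As usual, rates are understood up
to an arbitrarily small `ε > 0`; the number of probes is constant in the blocklength `n`. -/
def StronglyLocallyAchievable {X Y : Type*} [Fintype X] [Fintype Y] (p : PMF (X × Y))
    (R₁ R₂ : ℝ) : Prop :=
  ∀ ε : ℝ, 0 < ε → ∃ c : (n : ℕ) → LocalCode X Y n,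
    (∀ᶠ n : ℕ in atTop, ((c n).len₁ : ℝ) ≤ n * (R₁ + ε)) ∧
    (∀ᶠ n : ℕ in atTop, ((c n).len₂ : ℝ) ≤ n * (R₂ + ε)) ∧
    Tendsto (fun n => (c n).localError p) atTop (𝓝 0) ∧
    (fun n => ((c n).locality : ℝ)) =Θ[atTop] (fun _ => (1 : ℝ))

end

/-! If `x₁` and `x₂` share no compatible `y`, then merging them loses nothing once `Y` is known, yet
strictly lowers the entropy since both letters have positive mass. It remains to compress one
memoryless source at any rate above its entropy with boundedly many probes per symbol
(`exists_localSourceCode`), and to do so separately for the merged letter and for `Y`.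

Blocks of a constant length `b` are indexed inside a typical set. A small fraction of blocks is
atypical; their symbols, as pairs (position, letter), form a set `S` of at most `δ n` elements with
high probability. `S` is stored in a bit table of size `γ n`, with `γ` arbitrarily small, so that
eight probes decide membership without error (`exists_membership_table`). The table rests on
unbalanced expanders, obtained by counting (`exists_expander`), and on Hall's theorem. Asking the
table about every letter at position `i` either reveals the symbol or shows that its block is
typical, so one block index suffices. -/

/-! ### Counting proof that expanders exist -/

lemma choose_mul_pow_self_le (n k : ℕ) : (n.choose k : ℝ) * (k : ℝ) ^ k ≤ (3 * n : ℝ) ^ k := by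
  have h1 : (n.choose k : ℝ) ≤ (n : ℝ) ^ k / k.factorial := Nat.choose_le_pow_div k n
  have h2 : (k : ℝ) ^ k / k.factorial ≤ Real.exp k := Real.pow_div_factorial_le_exp _ (by positivity) k
  have h3 : Real.exp k ≤ 3 ^ k := by
    rw [show (k : ℝ) = k * 1 by ring, Real.exp_nat_mul]
    exact pow_le_pow_left₀ (Real.exp_pos _).le Real.exp_one_lt_three.le k
  calc (n.choose k : ℝ) * (k : ℝ) ^ k ≤ (n : ℝ) ^ k / k.factorial * (k : ℝ) ^ k := by gcongr
    _ = (n : ℝ) ^ k * ((k : ℝ) ^ k / k.factorial) := by ring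
    _ ≤ (n : ℝ) ^ k * 3 ^ k := by gcongr; exact h2.trans h3
    _ = (3 * n : ℝ) ^ k := by rw [mul_pow]; ring

/-- This bounds the share of graphs that send some `u` vertices into `6 * u` right vertices.
Bounding each binomial after multiplication by `u ^ u` and `(6 * u) ^ (6 * u)` leaves the constant
`3 * 3 ^ 6 * 6 ^ 2`; four times it is 314928, which yields the factor `1 / 4`. -/
lemma choose_mul_choose_mul_pow_le {v M m u : ℕ} (hu : 0 < u) (hum : u ≤ m)
    (h : 314928 * v * m ≤ M ^ 2) :
    (v.choose u : ℝ) * (M.choose (6 * u)) * ((6 * u : ℝ) ^ 8) ^ u ≤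
      (1 / 4) ^ u * ((M : ℝ) ^ 8) ^ u := by
  have h1 := choose_mul_pow_self_le v u
  have h2 := choose_mul_pow_self_le M (6 * u)
  have hu' : (0 : ℝ) < u := by exact_mod_cast hu
  have h3 : (314928 : ℝ) * v * u ≤ M ^ 2 := by
    have : 314928 * v * u ≤ M ^ 2 := (Nat.mul_le_mul_left _ hum).trans h
    exact_mod_cast this
  refine le_of_mul_le_mul_right ?_ (pow_pos hu' u)
  push_cast at h2
  calc (v.choose u : ℝ) * (M.choose (6 * u)) * ((6 * u : ℝ) ^ 8) ^ u * (u : ℝ) ^ u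
      = ((v.choose u : ℝ) * (u : ℝ) ^ u) * ((M.choose (6 * u)) * (6 * u : ℝ) ^ (6 * u)) *
          ((6 * u : ℝ) ^ 2) ^ u := by
        rw [pow_mul (6 * u : ℝ) 6 u, show (6 * u : ℝ) ^ 8 = (6 * u : ℝ) ^ 6 * (6 * u : ℝ) ^ 2 by ring,
          mul_pow ((6 * u : ℝ) ^ 6)]
        ring
    _ ≤ (3 * v : ℝ) ^ u * (3 * M : ℝ) ^ (6 * u) * ((6 * u : ℝ) ^ 2) ^ u := by gcongr
    _ = ((1 / 4) * ((314928 * v * u) * (M : ℝ) ^ 6)) ^ u * (u : ℝ) ^ u := by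
        rw [pow_mul, ← mul_pow, ← mul_pow, ← mul_pow]
        congr 1
        ring
    _ ≤ ((1 / 4) * ((M : ℝ) ^ 2 * (M : ℝ) ^ 6)) ^ u * (u : ℝ) ^ u := by gcongr
    _ = (1 / 4) ^ u * ((M : ℝ) ^ 8) ^ u * (u : ℝ) ^ u := by
        rw [← pow_add, mul_pow (1 / 4 : ℝ)]

/-- Neighbourhood of a set of vertices in a bipartite graph of left degree `d`. -/
def neighbourhood {V W : Type*} [DecidableEq W] {d : ℕ} (Γ : V → Fin d → W) (U : Finset V) :
    Finset W :=
  U.biUnion fun v => Finset.univ.image (Γ v)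

lemma mem_neighbourhood {V W : Type*} [DecidableEq W] {d : ℕ} {Γ : V → Fin d → W} {U : Finset V}
    {w : W} : w ∈ neighbourhood Γ U ↔ ∃ v ∈ U, ∃ j, Γ v j = w := by
  simp [neighbourhood]

lemma sum_quarter_pow_lt_one (m : ℕ) : ∑ u ∈ Finset.Icc 1 m, (1 / 4 : ℝ) ^ u < 1 := by
  have h : ∑ u ∈ Finset.Icc 1 m, (1 / 4 : ℝ) ^ u = (1 - (1 / 4) ^ m) / 3 := by
    induction m with
    | zero => simp
    | succ k ih => rw [Finset.sum_Icc_succ_top (by omega), ih]; ring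
  rw [h]
  have : (0 : ℝ) < (1 / 4) ^ m := by positivity
  linarith

/-- Bipartite expanders of left degree `8` exist. -/
lemma exists_expander (V : Type*) [Fintype V] [DecidableEq V] {M m : ℕ} (hM : 0 < M)
    (h6 : 6 * m ≤ M) (h : 314928 * Fintype.card V * m ≤ M ^ 2) :
    ∃ Γ : V → Fin 8 → Fin M, ∀ U : Finset V, U.card ≤ m →
      6 * U.card ≤ (neighbourhood Γ U).card := by
  by_contra! hcon
  set v := Fintype.card V with hv
  -- The box holds the graphs whose edges out of `U` all end in `C`. Every graph without the
  -- expansion lies in a box with `C.card = 6 * U.card`, and `h6` leaves room for such a `C`.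
  let box (U : Finset V) (C : Finset (Fin M)) : Finset (V → Fin 8 → Fin M) :=
    Fintype.piFinset fun v => if v ∈ U then Fintype.piFinset (fun _ => C) else Finset.univ
  have hbox (U : Finset V) (C : Finset (Fin M)) :
      (box U C).card = (C.card ^ 8) ^ U.card * (M ^ 8) ^ (v - U.card) := by
    simp only [box, Fintype.card_piFinset, apply_ite Finset.card, Finset.prod_ite,
      Finset.prod_const, Finset.card_univ, Fintype.card_fin, Fintype.card_pi, Finset.filter_mem_eq_inter]
    congr 2
    · simp
    · have : Finset.univ.filter (fun x => x ∉ U) = Uᶜ := by ext; simp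
      rw [this, Finset.card_compl]
  have hcover : (Finset.univ : Finset (V → Fin 8 → Fin M)) ⊆
      (Finset.Icc 1 m).biUnion fun u => (Finset.powersetCard u Finset.univ).biUnion fun U =>
        (Finset.powersetCard (6 * u) Finset.univ).biUnion fun C => box U C := by
    intro Γ _
    obtain ⟨U, hU, hlt⟩ := hcon Γ
    have hpos : 0 < U.card := by omega
    obtain ⟨C, hC, hCcard⟩ := Finset.exists_superset_card_eq (s := neighbourhood Γ U)
      (n := 6 * U.card) hlt.le (by rw [Fintype.card_fin]; omega)
    simp only [Finset.mem_biUnion, Finset.mem_Icc, Finset.mem_powersetCard, Finset.subset_univ,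
      true_and]
    refine ⟨U.card, ⟨hpos, hU⟩, U, rfl, C, hCcard, ?_⟩
    simp only [box, Fintype.mem_piFinset]
    intro w
    split_ifs with hw
    · simp only [Fintype.mem_piFinset]
      exact fun j => hC (mem_neighbourhood.2 ⟨w, hw, j, rfl⟩)
    · exact Finset.mem_univ _
  have hcount : (M ^ 8) ^ v ≤ ∑ u ∈ Finset.Icc 1 m,
      v.choose u * (M.choose (6 * u) * (((6 * u) ^ 8) ^ u * (M ^ 8) ^ (v - u))) := by
    calc (M ^ 8) ^ v = (Finset.univ : Finset (V → Fin 8 → Fin M)).card := by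
          simp [Finset.card_univ, hv]
      _ ≤ _ := Finset.card_le_card hcover
      _ ≤ _ := by
        refine Finset.card_biUnion_le.trans (Finset.sum_le_sum fun u _ => ?_)
        refine (Finset.card_biUnion_le_card_mul _ _
          (M.choose (6 * u) * (((6 * u) ^ 8) ^ u * (M ^ 8) ^ (v - u))) fun U hU => ?_).trans ?_
        · refine (Finset.card_biUnion_le_card_mul _ _
            (((6 * u) ^ 8) ^ u * (M ^ 8) ^ (v - u)) fun C hC => ?_).trans ?_
          · rw [hbox, (Finset.mem_powersetCard.1 hU).2, (Finset.mem_powersetCard.1 hC).2]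
          · rw [Finset.card_powersetCard, Finset.card_univ, Fintype.card_fin]
        · rw [Finset.card_powersetCard, Finset.card_univ]
  have hM' : (0 : ℝ) < ((M : ℝ) ^ 8) ^ v := by positivity
  have hreal : ((M : ℝ) ^ 8) ^ v ≤ ∑ u ∈ Finset.Icc 1 m, (1 / 4 : ℝ) ^ u * ((M : ℝ) ^ 8) ^ v := by
    calc ((M : ℝ) ^ 8) ^ v ≤ ∑ u ∈ Finset.Icc 1 m, (v.choose u : ℝ) *
          ((M.choose (6 * u) : ℝ) * (((6 * u : ℝ) ^ 8) ^ u * ((M : ℝ) ^ 8) ^ (v - u))) := by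
          exact_mod_cast hcount
      _ ≤ _ := by
        refine Finset.sum_le_sum fun u hu => ?_
        obtain ⟨hu1, hum⟩ := Finset.mem_Icc.1 hu
        by_cases huv : u ≤ v
        · calc _ = (v.choose u : ℝ) * (M.choose (6 * u)) * ((6 * u : ℝ) ^ 8) ^ u *
                ((M : ℝ) ^ 8) ^ (v - u) := by ring
            _ ≤ (1 / 4) ^ u * ((M : ℝ) ^ 8) ^ u * ((M : ℝ) ^ 8) ^ (v - u) := by
                gcongr ?_ * _
                exact choose_mul_choose_mul_pow_le hu1 hum h
            _ = _ := by rw [mul_assoc, ← pow_add, Nat.add_sub_cancel' huv]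
        · rw [Nat.choose_eq_zero_of_lt (by omega)]
          simp only [Nat.cast_zero, zero_mul]
          positivity
  rw [← Finset.sum_mul] at hreal
  have := sum_quarter_pow_lt_one m
  nlinarith

/-! ### Membership tables from expanders -/

/-- Vertices outside `S` half of whose edges lead to neighbours of `S` are no more numerous
than `S`. -/
lemma card_confused_le {V W : Type*} [Fintype V] [DecidableEq V] [DecidableEq W] {m : ℕ}
    {Γ : V → Fin 8 → W}
    (hΓ : ∀ U : Finset V, U.card ≤ 2 * m + 1 → 6 * U.card ≤ (neighbourhood Γ U).card)
    {S : Finset V} (hS : S.card ≤ m) :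
    (Finset.univ.filter fun v => v ∉ S ∧
      4 ≤ (Finset.univ.filter fun j => Γ v j ∈ neighbourhood Γ S).card).card ≤ S.card := by
  by_contra! hlt
  -- With `T` of size `S.card + 1`, expansion gives `S ∪ T` at least `12 * S.card + 6` neighbours.
  -- Counting eight per vertex of `S` and at most four new ones per vertex of `T` gives only `12 *
  -- S.card + 4`.
  obtain ⟨T, hT, hTcard⟩ := Finset.exists_subset_card_eq (Nat.succ_le_of_lt hlt)
  have hTmem : ∀ v ∈ T, v ∉ S ∧
      4 ≤ (Finset.univ.filter fun j => Γ v j ∈ neighbourhood Γ S).card := fun v hv => by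
    simpa using hT hv
  have hdisj : Disjoint S T := Finset.disjoint_right.2 fun v hv => (hTmem v hv).1
  have hcard : (S ∪ T).card = S.card + T.card := Finset.card_union_of_disjoint hdisj
  have hexp := hΓ (S ∪ T) (by omega)
  have hS8 : (neighbourhood Γ S).card ≤ S.card * 8 :=
    Finset.card_biUnion_le_card_mul _ _ _ fun v _ =>
      Finset.card_image_le.trans (by simp)
  have hsub : neighbourhood Γ (S ∪ T) ⊆ neighbourhood Γ S ∪
      T.biUnion fun v => (Finset.univ.filter fun j => Γ v j ∉ neighbourhood Γ S).image (Γ v) := by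
    intro w hw
    obtain ⟨v, hv, j, rfl⟩ := mem_neighbourhood.1 hw
    by_cases hin : Γ v j ∈ neighbourhood Γ S
    · exact Finset.mem_union_left _ hin
    · refine Finset.mem_union_right _ (Finset.mem_biUnion.2 ⟨v, ?_, ?_⟩)
      · exact (Finset.mem_union.1 hv).resolve_left fun hvS =>
          hin (mem_neighbourhood.2 ⟨v, hvS, j, rfl⟩)
      · exact Finset.mem_image_of_mem _ (by simpa using hin)
  have hT4 : (T.biUnion fun v =>
      (Finset.univ.filter fun j => Γ v j ∉ neighbourhood Γ S).image (Γ v)).card ≤ T.card * 4 := by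
    refine Finset.card_biUnion_le_card_mul _ _ _ fun v hv => Finset.card_image_le.trans ?_
    have h1 := (hTmem v hv).2
    have h2 := Finset.card_filter_add_card_filter_not (s := (Finset.univ : Finset (Fin 8)))
      (fun j => Γ v j ∈ neighbourhood Γ S)
    simp only [Finset.card_univ, Fintype.card_fin] at h2
    omega
  have := (Finset.card_le_card hsub).trans (Finset.card_union_le _ _)
  omega

/-- Hall's theorem gives every vertex of a small set six private neighbours. -/
lemma exists_private_neighbours {V W : Type*} [DecidableEq V] [DecidableEq W] {m : ℕ}
    {Γ : V → Fin 8 → W}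
    (hΓ : ∀ U : Finset V, U.card ≤ m → 6 * U.card ≤ (neighbourhood Γ U).card)
    {Q : Finset V} (hQ : Q.card ≤ m) :
    ∃ f : Q × Fin 6 → W, Function.Injective f ∧ ∀ x, ∃ j, Γ x.1 j = f x := by
  -- Hall's condition for six copies of each vertex is exactly sixfold expansion of the underlying
  -- vertices.
  have hall := (Finset.all_card_le_biUnion_card_iff_exists_injective
    (fun x : Q × Fin 6 => Finset.univ.image (Γ x.1))).1 ?_
  · obtain ⟨f, hf, hmem⟩ := hall
    exact ⟨f, hf, fun x => by
      obtain ⟨j, _, hj⟩ := Finset.mem_image.1 (hmem x)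
      exact ⟨j, hj⟩⟩
  · intro P
    set U : Finset V := P.image fun x => (x.1 : V) with hU
    have hUQ : U ⊆ Q := by
      intro v hv
      obtain ⟨x, _, rfl⟩ := Finset.mem_image.1 hv
      exact x.1.2
    have h1 : neighbourhood Γ U ⊆ P.biUnion fun x => Finset.univ.image (Γ x.1) := by
      intro w hw
      obtain ⟨v, hv, j, rfl⟩ := mem_neighbourhood.1 hw
      obtain ⟨x, hx, rfl⟩ := Finset.mem_image.1 hv
      exact Finset.mem_biUnion.2 ⟨x, hx, Finset.mem_image_of_mem _ (Finset.mem_univ _)⟩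
    have h2 : P.card ≤ (U ×ˢ (Finset.univ : Finset (Fin 6))).card := by
      refine Finset.card_le_card_of_injOn (fun x => ((x.1 : V), x.2)) ?_ ?_
      · intro x hx
        exact Finset.mem_coe.2 (Finset.mem_product.2
          ⟨Finset.mem_image_of_mem (fun x : Q × Fin 6 => (x.1 : V)) hx, Finset.mem_univ _⟩)
      · rintro ⟨a, b⟩ _ ⟨c, d⟩ _ h
        obtain ⟨h1, h2⟩ := Prod.mk.inj h
        exact Prod.ext (Subtype.ext h1) h2
    rw [Finset.card_product, Finset.card_univ, Fintype.card_fin] at h2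
    have h3 := hΓ U ((Finset.card_le_card hUQ).trans hQ)
    have h4 := Finset.card_le_card h1
    omega

/-- Small sets can be stored in one bit per right vertex of an expander so that membership of a
vertex is decided by a vote of its eight neighbours. -/
lemma exists_membership_table {V W : Type*} [Fintype V] [DecidableEq V] [DecidableEq W] {m : ℕ}
    {Γ : V → Fin 8 → W}
    (hΓ : ∀ U : Finset V, U.card ≤ 2 * m + 1 → 6 * U.card ≤ (neighbourhood Γ U).card)
    {S : Finset V} (hS : S.card ≤ m) :
    ∃ table : W → Bool, ∀ v,
      4 ≤ (Finset.univ.filter fun j => table (Γ v j) = true).card ↔ v ∈ S := by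
  set T := Finset.univ.filter fun v => v ∉ S ∧
      4 ≤ (Finset.univ.filter fun j => Γ v j ∈ neighbourhood Γ S).card with hT
  have hTcard : T.card ≤ S.card := card_confused_le hΓ hS
  obtain ⟨f, hf, hmem⟩ := exists_private_neighbours (Q := S ∪ T) hΓ
    ((Finset.card_union_le _ _).trans (by omega))
  have hown : ∀ (v : V) (hv : v ∈ S ∪ T),
      6 ≤ (Finset.univ.filter fun j => ∃ l, f (⟨v, hv⟩, l) = Γ v j).card := by
    intro v hv
    choose g hg using fun l => hmem (⟨v, hv⟩, l)
    have hinj : Function.Injective g := fun a b hab => by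
      have := (hg a).symm.trans ((congrArg (Γ v) hab).trans (hg b))
      simpa using hf this
    calc 6 = (Finset.univ.image g).card := by
          rw [Finset.card_image_of_injective _ hinj]; simp
      _ ≤ _ := Finset.card_le_card fun j hj => by
          obtain ⟨l, _, rfl⟩ := Finset.mem_image.1 hj
          simpa using ⟨l, (hg l).symm⟩
  classical
  -- Ones are placed exactly at the private neighbours of `S`. A member sees at least six ones; a
  -- vertex of `T` has six private edges reading zero, hence at most two ones; any other vertex has
  -- fewer than four edges into the neighbourhood of `S`.
  refine ⟨fun w => decide (∃ x : (S ∪ T : Finset V) × Fin 6, (x.1 : V) ∈ S ∧ f x = w), fun v => ?_⟩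
  simp only [decide_eq_true_eq]
  constructor
  · intro h4
    by_contra hvS
    by_cases hvT : v ∈ T
    · have hv : v ∈ S ∪ T := Finset.mem_union_right _ hvT
      have h6 := hown v hv
      have hd : Disjoint
          (Finset.univ.filter fun j => ∃ x : (S ∪ T : Finset V) × Fin 6, (x.1 : V) ∈ S ∧ f x = Γ v j)
          (Finset.univ.filter fun j => ∃ l, f (⟨v, hv⟩, l) = Γ v j) := by
        rw [Finset.disjoint_filter]
        rintro j _ ⟨x, hxS, hx⟩ ⟨l, hl⟩
        have := hf (hx.trans hl.symm)
        subst this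
        exact hvS hxS
      have := Finset.card_le_univ (Finset.disjUnion _ _ hd)
      rw [Finset.card_disjUnion, Fintype.card_fin] at this
      omega
    · refine hvT (Finset.mem_filter.2 ⟨Finset.mem_univ _, hvS, h4.trans (Finset.card_le_card ?_)⟩)
      intro j hj
      obtain ⟨x, hxS, hx⟩ := (Finset.mem_filter.1 hj).2
      obtain ⟨j', hj'⟩ := hmem x
      exact Finset.mem_filter.2 ⟨Finset.mem_univ _,
        mem_neighbourhood.2 ⟨x.1, hxS, j', hj'.trans hx⟩⟩
  · intro hvS
    have hv : v ∈ S ∪ T := Finset.mem_union_left _ hvS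
    refine (le_trans (by norm_num) (hown v hv)).trans (Finset.card_le_card ?_)
    intro j hj
    obtain ⟨l, hl⟩ := (Finset.mem_filter.1 hj).2
    exact Finset.mem_filter.2 ⟨Finset.mem_univ _, (⟨v, hv⟩, l), hvS, hl⟩

/-! ### Finite product probability and a Chernoff bound -/

lemma PMF.sum_toReal_eq_one {α : Type*} [Fintype α] (p : PMF α) : ∑ a, (p a).toReal = 1 := by
  rw [← ENNReal.toReal_sum fun a _ => p.apply_ne_top a, ← tsum_fintype (L := .unconditional _),
    p.tsum_coe, ENNReal.toReal_one]

lemma PMF.sum_prod_toReal_eq_one {α : Type*} [Fintype α] (p : PMF α) (n : ℕ) :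
    ∑ s : Fin n → α, ∏ j, (p (s j)).toReal = 1 := by
  rw [← Fintype.sum_pow fun a => (p a).toReal, p.sum_toReal_eq_one, one_pow]

lemma PMF.map_apply_toReal {α β : Type*} [Fintype α] [DecidableEq β] (p : PMF α) (g : α → β)
    (b : β) : ((p.map g) b).toReal = ∑ a with g a = b, (p a).toReal := by
  rw [PMF.map_apply, tsum_fintype, ENNReal.toReal_sum, Finset.sum_filter]
  · refine Finset.sum_congr rfl fun a _ => ?_
    by_cases h : g a = b
    · simp [h]
    · simp [h, Ne.symm h]
  · intro a _
    split_ifs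
    · exact p.apply_ne_top a
    · exact ENNReal.zero_ne_top

section iidProb

variable {α : Type*} [Fintype α] (p : PMF α) {n : ℕ}

lemma iidProb_nonneg (E : Set (Fin n → α)) : 0 ≤ iidProb p n E :=
  Finset.sum_nonneg fun _ _ => Set.indicator_nonneg
    (fun _ _ => Finset.prod_nonneg fun _ _ => ENNReal.toReal_nonneg) _

/-- Inclusion is required only on sequences of possible letters, because recovery from the merged
letter and `Y` works only on the support. -/
lemma iidProb_mono_of_pos {E F : Set (Fin n → α)} (h : ∀ s ∈ E, (∀ j, 0 < p (s j)) → s ∈ F) :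
    iidProb p n E ≤ iidProb p n F := by
  classical
  refine Finset.sum_le_sum fun s _ => ?_
  have hnn : 0 ≤ ∏ j, (p (s j)).toReal := Finset.prod_nonneg fun _ _ => ENNReal.toReal_nonneg
  by_cases hE : s ∈ E
  · by_cases hpos : ∀ j, 0 < p (s j)
    · simp [hE, h s hE hpos]
    · push Not at hpos
      obtain ⟨j, hj⟩ := hpos
      have h0 : ∏ j, (p (s j)).toReal = 0 :=
        Finset.prod_eq_zero (Finset.mem_univ j) (by simp [le_antisymm hj (zero_le)])
      simp [Set.indicator_apply, h0]
  · rw [Set.indicator_of_notMem hE]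
    exact Set.indicator_nonneg (fun _ _ => Finset.prod_nonneg fun _ _ => ENNReal.toReal_nonneg) _

lemma iidProb_union_le (E F : Set (Fin n → α)) :
    iidProb p n (E ∪ F) ≤ iidProb p n E + iidProb p n F := by
  classical
  unfold iidProb
  rw [← Finset.sum_add_distrib]
  refine Finset.sum_le_sum fun s _ => ?_
  have hnn : 0 ≤ ∏ j, (p (s j)).toReal := Finset.prod_nonneg fun _ _ => ENNReal.toReal_nonneg
  by_cases hE : s ∈ E <;> by_cases hF : s ∈ F <;> simp [hE, hF, hnn]

lemma iidProb_map {β : Type*} [Fintype β] (g : α → β) (E : Set (Fin n → β)) :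
    iidProb (p.map g) n E = iidProb p n {s | (fun j => g (s j)) ∈ E} := by
  classical
  unfold iidProb
  rw [← Finset.sum_fiberwise_of_maps_to (s := (Finset.univ : Finset (Fin n → α)))
    (t := Finset.univ) (g := fun s j => g (s j)) fun _ _ => Finset.mem_univ _]
  refine Finset.sum_congr rfl fun u _ => ?_
  have hfib : ∏ j, ((p.map g) (u j)).toReal =
      ∑ s : Fin n → α with (fun j => g (s j)) = u, ∏ j, (p (s j)).toReal := by
    simp only [PMF.map_apply_toReal]
    rw [Finset.prod_univ_sum]
    refine Finset.sum_congr ?_ fun _ _ => rfl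
    ext s
    simp [Fintype.mem_piFinset, funext_iff]
  have hcongr : ∀ s ∈ (Finset.univ.filter fun s : Fin n → α => (fun j => g (s j)) = u),
      ({s | (fun j => g (s j)) ∈ E} : Set (Fin n → α)).indicator
        (fun s => ∏ j, (p (s j)).toReal) s = if u ∈ E then ∏ j, (p (s j)).toReal else 0 := by
    intro s hs
    have hiff : s ∈ ({s | (fun j => g (s j)) ∈ E} : Set (Fin n → α)) ↔ u ∈ E := by
      rw [← (Finset.mem_filter.1 hs).2]
      rfl
    simp only [Set.indicator_apply, hiff]
  rw [Finset.sum_congr rfl hcongr, Set.indicator_apply]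
  split_ifs
  · exact hfib
  · simp

/-- Expectation of a product over disjoint blocks of coordinates. -/
lemma sum_prod_mul_prod_blocks {N b r : ℕ} (e : Fin n ≃ (Fin N × Fin b) ⊕ Fin r)
    (g : (Fin b → α) → ℝ) :
    ∑ s : Fin n → α, (∏ i, (p (s i)).toReal) * ∏ j, g (fun t => s (e.symm (Sum.inl (j, t)))) =
      (∑ z : Fin b → α, (∏ t, (p (z t)).toReal) * g z) ^ N := by
  let E : (Fin n → α) ≃ (Fin N → Fin b → α) × (Fin r → α) :=
    ((Equiv.arrowCongr e (Equiv.refl α)).trans (Equiv.sumArrowEquivProdArrow _ _ _)).trans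
      (Equiv.prodCongr (Equiv.curry _ _ _) (Equiv.refl _))
  rw [Fintype.sum_equiv E _ (fun x => (∏ j, (∏ t, (p (x.1 j t)).toReal) * g (x.1 j)) *
    ∏ k, (p (x.2 k)).toReal), Fintype.sum_prod_type]
  · simp_rw [← Finset.mul_sum]
    simp only [p.sum_prod_toReal_eq_one, mul_one]
    rw [Fintype.sum_pow]
  · intro s
    rw [← Equiv.prod_comp e.symm, Fintype.prod_sum_type, Fintype.prod_prod_type,
      Finset.prod_mul_distrib]
    simp only [E, Equiv.trans_apply, Equiv.prodCongr_apply, Prod.map, Equiv.curry_apply,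
      Equiv.sumArrowEquivProdArrow, Equiv.arrowCongr, Equiv.coe_fn_mk, Function.curry,
      Function.comp_def, Equiv.refl_apply]
    exact mul_right_comm _ _ _

/-- Chernoff bound for the number of blocks outside a given set. -/
lemma iidProb_lt_card_bad_blocks_mul_le [DecidableEq α] {N b r : ℕ}
    (e : Fin n ≃ (Fin N × Fin b) ⊕ Fin r) (T : Finset (Fin b → α)) (K : ℕ) :
    iidProb p n {s | K < (Finset.univ.filter fun j =>
      (fun t => s (e.symm (Sum.inl (j, t)))) ∉ T).card} * 2 ^ K ≤
      Real.exp (iidProb p b {z | z ∉ T}) ^ N := by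
  classical
  -- Markov's inequality is applied to two to the number of bad blocks, whose expectation factors
  -- over the blocks.
  have hg : ∑ z : Fin b → α, (∏ t, (p (z t)).toReal) * (if z ∉ T then (2 : ℝ) else 1) =
      1 + iidProb p b {z | z ∉ T} := by
    conv_rhs => rw [← p.sum_prod_toReal_eq_one b]
    rw [iidProb, ← Finset.sum_add_distrib]
    refine Finset.sum_congr rfl fun z _ => ?_
    by_cases hz : z ∈ T
    · simp [hz]
    · simp [hz, mul_two]
  calc _ ≤ ∑ s : Fin n → α, (∏ i, (p (s i)).toReal) *
        ∏ j, (if (fun t => s (e.symm (Sum.inl (j, t)))) ∉ T then (2 : ℝ) else 1) := by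
        rw [iidProb, Finset.sum_mul]
        refine Finset.sum_le_sum fun s _ => ?_
        have hnn : 0 ≤ ∏ i, (p (s i)).toReal :=
          Finset.prod_nonneg fun _ _ => ENNReal.toReal_nonneg
        rw [Finset.prod_ite, Finset.prod_const, Finset.prod_const, one_pow, mul_one,
          Set.indicator_apply]
        split_ifs with hs
        · have := pow_le_pow_right₀ (one_le_two (α := ℝ)) (Set.mem_ofPred_eq ▸ hs : K < _).le
          exact mul_le_mul_of_nonneg_left this hnn
        · rw [zero_mul]; positivity
    _ = (1 + iidProb p b {z | z ∉ T}) ^ N := by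
      rw [sum_prod_mul_prod_blocks p e fun z => if z ∉ T then (2 : ℝ) else 1, hg]
    _ ≤ _ := by
      have := iidProb_nonneg p {z | z ∉ T}
      gcongr
      linarith [Real.add_one_le_exp (iidProb p b {z | z ∉ T})]

end iidProb

/-! ### Source coding above the entropy -/

lemma HasDerivAt.exists_pos_lt {h : ℝ → ℝ} {d : ℝ} (hd : HasDerivAt h d 0) (hneg : d < 0) :
    ∃ s, 0 < s ∧ h s < h 0 := by
  have hslope := (hasDerivAt_iff_tendsto_slope.1 hd).mono_left (nhdsGT_le_nhdsNE 0)
  obtain ⟨s, hs, hs0⟩ := ((hslope.eventually (gt_mem_nhds hneg)).and self_mem_nhdsWithin).exists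
  refine ⟨s, hs0, ?_⟩
  rw [slope_def_field, sub_zero] at hs
  have := (div_neg_iff.1 hs)
  have hs0' : 0 < s := hs0
  rcases this with h | h <;> linarith [h.1, h.2]

lemma shannonEntropy_nonneg {α : Type*} [Fintype α] (p : PMF α) : 0 ≤ shannonEntropy p := by
  refine Finset.sum_nonneg fun a _ => div_nonneg ?_ (Real.log_nonneg one_le_two)
  refine Real.negMulLog_nonneg ENNReal.toReal_nonneg ?_
  exact ENNReal.toReal_le_of_le_ofReal zero_le_one (by simpa using p.coe_le_one a)

/-- At `s = 0` the sum is one and its derivative is `(shannonEntropy p - R) * Real.log 2`, which is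
negative. -/
lemma exists_moment_lt_one {α : Type*} [Fintype α] (p : PMF α) {R : ℝ}
    (hR : shannonEntropy p < R) :
    ∃ s, 0 < s ∧ ∑ a, (p a).toReal * Real.exp (-s * (Real.log (p a).toReal + R * Real.log 2)) < 1 := by
  have hd : HasDerivAt
      (fun s : ℝ => ∑ a, (p a).toReal * Real.exp (-s * (Real.log (p a).toReal + R * Real.log 2)))
      (∑ a, (p a).toReal * (Real.exp (-0 * (Real.log (p a).toReal + R * Real.log 2)) *
        (-1 * (Real.log (p a).toReal + R * Real.log 2)))) 0 := by
    refine HasDerivAt.fun_sum fun a _ => ?_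
    exact (((hasDerivAt_neg (0 : ℝ)).mul_const _).exp).const_mul _
  have hlog : 0 < Real.log 2 := Real.log_pos one_lt_two
  obtain ⟨s, hs, hlt⟩ := hd.exists_pos_lt (by
    have h1 : ∑ a, (p a).toReal * (Real.exp (-0 * (Real.log (p a).toReal + R * Real.log 2)) *
        (-1 * (Real.log (p a).toReal + R * Real.log 2))) =
        (shannonEntropy p - R) * Real.log 2 := by
      have h2 : ∀ a, (p a).toReal * (Real.exp (-0 * (Real.log (p a).toReal + R * Real.log 2)) *
        (-1 * (Real.log (p a).toReal + R * Real.log 2))) =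
          Real.negMulLog (p a).toReal / Real.log 2 * Real.log 2 -
            (p a).toReal * (R * Real.log 2) := fun a => by
        rw [div_mul_cancel₀ _ hlog.ne', Real.negMulLog]
        simp
        ring
      simp_rw [h2]
      rw [Finset.sum_sub_distrib, ← Finset.sum_mul, ← Finset.sum_mul, p.sum_toReal_eq_one,
        shannonEntropy]
      ring
    rw [h1]
    exact mul_neg_of_neg_of_pos (by linarith) hlog)
  refine ⟨s, hs, hlt.trans_eq ?_⟩
  simp [p.sum_toReal_eq_one]

/-- Almost lossless fixed-length source coding at any rate above the entropy. -/
lemma eventually_exists_typical {α : Type*} [Fintype α] (p : PMF α) {R η : ℝ}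
    (hR : shannonEntropy p < R) (hη : 0 < η) :
    ∀ᶠ b : ℕ in atTop, ∃ T : Finset (Fin b → α),
      (T.card : ℝ) ≤ 2 ^ (b * R) ∧ iidProb p b {z | z ∉ T} ≤ η := by
  classical
  obtain ⟨s, hs, hlt⟩ := exists_moment_lt_one p hR
  set ρ := ∑ a, (p a).toReal * Real.exp (-s * (Real.log (p a).toReal + R * Real.log 2)) with hρ
  have hρ0 : 0 ≤ ρ := Finset.sum_nonneg fun a _ => by positivity
  filter_upwards [(tendsto_pow_atTop_nhds_zero_of_lt_one hρ0 hlt).eventually (gt_mem_nhds hη)]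
    with b hb
  -- Sequences of mass at least `2 ^ (-(b * R))` number at most `2 ^ (b * R)`. For the others the
  -- exponential tilt is at least one, so their total mass is at most `ρ ^ b`.
  refine ⟨Finset.univ.filter fun z => (2 : ℝ) ^ (-(b * R)) ≤ ∏ t, (p (z t)).toReal, ?_, ?_⟩
  · have h2 := Finset.card_nsmul_le_sum
      (Finset.univ.filter fun z : Fin b → α => (2 : ℝ) ^ (-(b * R)) ≤ ∏ t, (p (z t)).toReal)
      (fun z => ∏ t, (p (z t)).toReal) _ fun z hz => (Finset.mem_filter.1 hz).2
    have h3 := h2.trans (Finset.sum_le_univ_sum_of_nonneg fun z =>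
      Finset.prod_nonneg fun _ _ => ENNReal.toReal_nonneg)
    rw [p.sum_prod_toReal_eq_one, nsmul_eq_mul] at h3
    rwa [Real.rpow_neg zero_le_two, ← div_eq_mul_inv,
      div_le_one (by positivity), ← Real.rpow_neg zero_le_two] at h3
  · refine le_trans ?_ hb.le
    rw [hρ, Fintype.sum_pow, iidProb]
    refine Finset.sum_le_sum fun z _ => ?_
    have hnn : 0 ≤ ∏ t, (p (z t)).toReal := Finset.prod_nonneg fun _ _ => ENNReal.toReal_nonneg
    rw [Set.indicator_apply]
    split_ifs with hz
    · rw [Finset.prod_mul_distrib, ← Real.exp_sum]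
      have hz' : ∏ t, (p (z t)).toReal < (2 : ℝ) ^ (-(b * R)) := by simpa using hz
      -- Null sequences are set apart because `Real.log 0 = 0` breaks the logarithm of the product.
      by_cases h0 : ∏ t, (p (z t)).toReal = 0
      · simp [h0]
      · refine le_mul_of_one_le_right hnn (Real.one_le_exp ?_)
        have hlog := Real.log_lt_log (lt_of_le_of_ne hnn (Ne.symm h0)) hz'
        rw [Real.log_prod (fun t ht => (Finset.prod_ne_zero_iff.1 h0) t ht),
          Real.log_rpow two_pos] at hlog
        rw [← Finset.mul_sum, Finset.sum_add_distrib, Finset.sum_const, Finset.card_univ,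
          Fintype.card_fin, nsmul_eq_mul]
        nlinarith
    · positivity

/-! ### Local codes built from blocks and a table -/

/-- A fixed-length code for a single source in which the decoder of every symbol depends only on
the codeword components in a fixed set. -/
structure LocalSourceCode (A : Type*) (n : ℕ) where
  /-- codeword length -/
  len : ℕ
  /-- encoder -/
  enc : (Fin n → A) → Fin len → Bool
  /-- probed components -/
  probe : Fin n → Finset (Fin len)
  /-- decoder -/
  dec : Fin n → (Fin len → Bool) → A
  dec_congr : ∀ i o o', (∀ x ∈ probe i, o x = o' x) → dec i o = dec i o'

namespace LocalSourceCode

/-- The code with codeword components indexed by an arbitrary finite type. -/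
noncomputable def ofIndex {A : Type*} {n : ℕ} {I : Type} [Fintype I]
    (enc : (Fin n → A) → I → Bool) (probe : Fin n → Finset I) (dec : Fin n → (I → Bool) → A)
    (h : ∀ i o o', (∀ x ∈ probe i, o x = o' x) → dec i o = dec i o') : LocalSourceCode A n where
  len := Fintype.card I
  enc s x := enc s ((Fintype.equivFin I).symm x)
  probe i := (probe i).map (Fintype.equivFin I).toEmbedding
  dec i o := dec i fun x => o (Fintype.equivFin I x)
  dec_congr i _ _ ho := h i _ _ fun _ hx => ho _ (Finset.mem_map_of_mem _ hx)

lemma ofIndex_dec_enc {A : Type*} {n : ℕ} {I : Type} [Fintype I]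
    (enc : (Fin n → A) → I → Bool) (probe : Fin n → Finset I) (dec : Fin n → (I → Bool) → A)
    (h : ∀ i o o', (∀ x ∈ probe i, o x = o' x) → dec i o = dec i o') (i : Fin n)
    (s : Fin n → A) :
    (ofIndex enc probe dec h).dec i ((ofIndex enc probe dec h).enc s) = dec i (enc s) := by
  simp [ofIndex]

end LocalSourceCode

section BlockCode

variable {A : Type*} [DecidableEq A] {n N b r k M m : ℕ}

/-- The `j`-th block of a sequence. -/
def block (e : Fin n ≃ (Fin N × Fin b) ⊕ Fin r) (s : Fin n → A) (j : Fin N) : Fin b → A :=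
  fun t => s (e.symm (Sum.inl (j, t)))

/-- The symbols, with their positions, that lie outside the blocks belonging to `T`. -/
def uncovered (e : Fin n ≃ (Fin N × Fin b) ⊕ Fin r) (T : Finset (Fin b → A)) (s : Fin n → A) :
    Finset (Fin n × A) :=
  (((Finset.univ.filter fun j => block e s j ∉ T) ×ˢ (Finset.univ : Finset (Fin b))).disjSum
    (Finset.univ : Finset (Fin r))).image fun x => (e.symm x, s (e.symm x))

lemma card_uncovered_le (e : Fin n ≃ (Fin N × Fin b) ⊕ Fin r) (T : Finset (Fin b → A))
    (s : Fin n → A) :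
    (uncovered e T s).card ≤ (Finset.univ.filter fun j => block e s j ∉ T).card * b + r := by
  refine Finset.card_image_le.trans ?_
  rw [Finset.card_disjSum, Finset.card_product, Finset.card_univ, Fintype.card_fin,
    Finset.card_univ, Fintype.card_fin]

lemma eq_of_mem_uncovered {e : Fin n ≃ (Fin N × Fin b) ⊕ Fin r} {T : Finset (Fin b → A)}
    {s : Fin n → A} {i : Fin n} {a : A} (h : (i, a) ∈ uncovered e T s) : s i = a := by
  obtain ⟨x, _, hx⟩ := Finset.mem_image.1 h
  obtain ⟨rfl, rfl⟩ := Prod.mk.inj hx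
  rfl

lemma exists_block_mem_of_notMem_uncovered {e : Fin n ≃ (Fin N × Fin b) ⊕ Fin r}
    {T : Finset (Fin b → A)} {s : Fin n → A} {i : Fin n} (h : (i, s i) ∉ uncovered e T s) :
    ∃ j t, e i = Sum.inl (j, t) ∧ block e s j ∈ T := by
  rcases hi : e i with ⟨j, t⟩ | x
  · refine ⟨j, t, rfl, ?_⟩
    by_contra hT
    refine h (Finset.mem_image.2 ⟨e i, ?_, by simp⟩)
    rw [hi]
    simpa using hT
  · refine absurd (Finset.mem_image.2 ⟨e i, ?_, by simp⟩) h
    rw [hi]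
    simp

/-- Blocks of `T` are enumerated, and all other symbols are stored in a membership table. -/
lemma exists_blockCode [Fintype A] [Nonempty A] (e : Fin n ≃ (Fin N × Fin b) ⊕ Fin r)
    (T : Finset (Fin b → A)) (hT : T.card ≤ 2 ^ k) {Γ : Fin n × A → Fin 8 → Fin M}
    (hΓ : ∀ U : Finset (Fin n × A), U.card ≤ 2 * m + 1 → 6 * U.card ≤ (neighbourhood Γ U).card) :
    ∃ c : LocalSourceCode A n, c.len = N * k + M ∧
      (∀ i, (c.probe i).Nonempty ∧ (c.probe i).card ≤ k + 8 * Fintype.card A) ∧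
      ∀ s, (Finset.univ.filter fun j => block e s j ∉ T).card * b + r ≤ m →
        ∀ i, c.dec i (c.enc s) = s i := by
  classical
  obtain ⟨φ, hφ⟩ : ∃ φ : (Fin b → A) → Fin k → Bool, Set.InjOn φ T := by
    have hle : Fintype.card T ≤ Fintype.card (Fin k → Bool) := by simpa using hT
    obtain ⟨f⟩ := Function.Embedding.nonempty_of_card_le hle
    refine ⟨fun z => if hz : z ∈ T then f ⟨z, hz⟩ else fun _ => false, ?_⟩
    intro z hz z' hz' h
    have hz1 : z ∈ T := hz
    have hz2 : z' ∈ T := hz'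
    simp only [hz1, hz2, dif_pos] at h
    exact congrArg Subtype.val (f.injective h)
  have htab : ∀ S : Finset (Fin n × A), ∃ table : Fin M → Bool, S.card ≤ m →
      ∀ v, 4 ≤ (Finset.univ.filter fun j => table (Γ v j) = true).card ↔ v ∈ S := by
    intro S
    by_cases hS : S.card ≤ m
    · obtain ⟨t, ht⟩ := exists_membership_table hΓ hS
      exact ⟨t, fun _ => ht⟩
    · exact ⟨fun _ => false, fun h => absurd h hS⟩
  choose table htable using htab
  let enc : (Fin n → A) → (Fin N × Fin k) ⊕ Fin M → Bool := fun s =>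
    Sum.elim (fun x => φ (block e s x.1) x.2) (table (uncovered e T s))
  let own : (Fin N × Fin b) ⊕ Fin r → Finset (Fin N × Fin k) :=
    Sum.elim (fun x => Finset.univ.image fun l => (x.1, l)) fun _ => ∅
  let probe : Fin n → Finset ((Fin N × Fin k) ⊕ Fin M) := fun i =>
    (own (e i)).disjSum (Finset.univ.image fun x : A × Fin 8 => Γ (i, x.1) x.2)
  let vote : ((Fin N × Fin k) ⊕ Fin M → Bool) → Fin n → A → Prop := fun o i a =>
    4 ≤ (Finset.univ.filter fun j => o (Sum.inr (Γ (i, a) j)) = true).card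
  -- When the table is valid, only the true letter can win the vote. If none wins, position `i` lies
  -- in a block of `T`, so the arbitrary letter for the remainder is never used.
  let dec : Fin n → ((Fin N × Fin k) ⊕ Fin M → Bool) → A := fun i o =>
    if h : ∃ a, vote o i a then h.choose
    else Sum.elim (fun x => Function.invFunOn φ T (fun l => o (Sum.inl (x.1, l))) x.2)
      (fun _ => Classical.arbitrary A) (e i)
  have hdec : ∀ i o o', (∀ x ∈ probe i, o x = o' x) → dec i o = dec i o' := by
    intro i o o' h
    have hvote : vote o i = vote o' i := by
      funext a
      have : ∀ j, o (Sum.inr (Γ (i, a) j)) = o' (Sum.inr (Γ (i, a) j)) := fun j =>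
        h _ (Finset.inr_mem_disjSum.2 (Finset.mem_image.2 ⟨(a, j), Finset.mem_univ _, rfl⟩))
      simp only [vote, this]
    have hown : ∀ x ∈ own (e i), o (Sum.inl x) = o' (Sum.inl x) := fun x hx =>
      h _ (Finset.inl_mem_disjSum.2 hx)
    simp only [dec, hvote]
    rcases hi : e i with ⟨j, t⟩ | x
    · have : ∀ l, o (Sum.inl (j, l)) = o' (Sum.inl (j, l)) := fun l => hown _ (by
        rw [hi]
        exact Finset.mem_image_of_mem _ (Finset.mem_univ _))
      simp only [Sum.elim_inl, this]
    · rfl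
  refine ⟨LocalSourceCode.ofIndex enc probe dec hdec, by simp [LocalSourceCode.ofIndex], ?_, ?_⟩
  · intro i
    simp only [LocalSourceCode.ofIndex, Finset.map_nonempty, Finset.card_map]
    constructor
    · exact ⟨Sum.inr (Γ (i, Classical.arbitrary A) 0), Finset.inr_mem_disjSum.2
        (Finset.mem_image.2 ⟨(Classical.arbitrary A, 0), Finset.mem_univ _, rfl⟩)⟩
    · rw [Finset.card_disjSum]
      refine add_le_add ?_ (Finset.card_image_le.trans ?_)
      · rcases e i with x | x
        · exact Finset.card_image_le.trans (by simp)
        · simp [own]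
      · simp [mul_comm]
  · intro s hs i
    rw [LocalSourceCode.ofIndex_dec_enc]
    have hvote : ∀ a, vote (enc s) i a ↔ (i, a) ∈ uncovered e T s := fun a =>
      htable _ ((card_uncovered_le e T s).trans hs) (i, a)
    simp only [dec]
    split_ifs with h
    · exact (eq_of_mem_uncovered ((hvote _).1 h.choose_spec)).symm
    · obtain ⟨j, t, hi, hj⟩ := exists_block_mem_of_notMem_uncovered (e := e) (T := T) (s := s)
        (i := i) fun hmem => h ⟨_, (hvote _).2 hmem⟩
      rw [hi, Sum.elim_inl]
      have : Function.invFunOn φ T (φ (block e s j)) = block e s j :=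
        hφ.leftInvOn_invFunOn hj
      calc _ = Function.invFunOn φ T (φ (block e s j)) t := rfl
        _ = s i := by rw [this, block, ← hi, Equiv.symm_apply_apply]

end BlockCode

/-! ### Choice of parameters and the single-source theorem -/

lemma mul_le_sq_of_le {x γ B M δ' m : ℝ} (hx : 0 ≤ x) (hγ : 0 ≤ γ) (hB : 0 ≤ B)
    (hM : γ * x / 2 ≤ M) (hm : m ≤ 2 * (δ' * x) + 1) (hδ : 16 * B * δ' ≤ γ ^ 2)
    (hxB : 8 * B ≤ γ ^ 2 * x) : B * x * m ≤ M ^ 2 := by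
  have h1 : (γ * x / 2) ^ 2 ≤ M ^ 2 := by gcongr
  have h2 : B * x * m ≤ B * x * (2 * (δ' * x) + 1) := by gcongr
  have h3 : 16 * B * δ' * x ^ 2 ≤ γ ^ 2 * x ^ 2 := by gcongr
  have h4 : 8 * B * x ≤ γ ^ 2 * x * x := by gcongr
  nlinarith

/-- For linear-size tables there are expanders that serve all sets of linear size. -/
lemma eventually_exists_expander (A : Type*) [Fintype A] [DecidableEq A] [Nonempty A] {γ : ℝ}
    (hγ : 0 < γ) :
    ∃ δ : ℝ, 0 < δ ∧ ∀ᶠ n : ℕ in atTop, ∃ Γ : Fin n × A → Fin 8 → Fin ⌊γ * n⌋₊,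
      ∀ U : Finset (Fin n × A), U.card ≤ 2 * ⌊δ * n⌋₊ + 1 →
        6 * U.card ≤ (neighbourhood Γ U).card := by
  have ha : (0 : ℝ) < Fintype.card A := by exact_mod_cast Fintype.card_pos
  set B : ℝ := 314928 * Fintype.card A with hB
  have hBpos : 0 < B := by positivity
  -- The first bound leaves room for `6 * (2 * m + 1) ≤ M` despite the floors; the second gives the
  -- quadratic condition of `exists_expander`.
  refine ⟨min (γ / 24) (γ ^ 2 / (16 * B)), by positivity, ?_⟩
  set δ := min (γ / 24) (γ ^ 2 / (16 * B)) with hδ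
  have hδ1 : δ ≤ γ / 24 := min_le_left _ _
  have hδ2 : 16 * B * δ ≤ γ ^ 2 := by
    have : δ ≤ γ ^ 2 / (16 * B) := min_le_right _ _
    rw [le_div_iff₀ (by positivity)] at this
    linarith
  have hδ0 : 0 < δ := by positivity
  filter_upwards [tendsto_natCast_atTop_atTop.eventually_ge_atTop (14 / γ),
    tendsto_natCast_atTop_atTop.eventually_ge_atTop (8 * B / γ ^ 2)] with n hn1 hn2
  rw [div_le_iff₀ hγ] at hn1
  rw [div_le_iff₀ (by positivity)] at hn2
  have hM : γ * n - 1 < ⌊γ * n⌋₊ := Nat.sub_one_lt_floor _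
  have hm : (⌊δ * n⌋₊ : ℝ) ≤ δ * n := Nat.floor_le (by positivity)
  have hn0 : (0 : ℝ) ≤ n := Nat.cast_nonneg n
  have hδn : δ * n ≤ γ / 24 * n := by gcongr
  refine exists_expander _ ?_ ?_ ?_
  · have : (0 : ℝ) < ⌊γ * n⌋₊ := by linarith
    exact_mod_cast this
  · have : (6 * (2 * ⌊δ * n⌋₊ + 1) : ℝ) ≤ ⌊γ * n⌋₊ := by linarith
    exact_mod_cast this
  · have := mul_le_sq_of_le (x := n) (γ := γ) (B := B) (M := ⌊γ * n⌋₊) (δ' := δ)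
      (m := 2 * ⌊δ * n⌋₊ + 1) hn0 hγ.le hBpos.le (by linarith) (by linarith) hδ2 (by linarith)
    rw [Fintype.card_prod, Fintype.card_fin]
    have h' : (314928 * (n * Fintype.card A) * (2 * ⌊δ * n⌋₊ + 1) : ℝ) ≤ (⌊γ * n⌋₊ : ℝ) ^ 2 := by
      rw [hB] at this
      linarith
    exact_mod_cast h'

/-- The number of bad blocks exceeds a linear bound with vanishing probability. -/
lemma iidProb_lt_card_bad_blocks_le {A : Type*} [Fintype A] [DecidableEq A] (q : PMF A)
    {n N b r : ℕ} (e : Fin n ≃ (Fin N × Fin b) ⊕ Fin r) (T : Finset (Fin b → A)) {θ : ℝ}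
    (hT : iidProb q b {z | z ∉ T} ≤ θ * Real.log 2 / 2) :
    iidProb q n {s | ⌊θ * N⌋₊ < (Finset.univ.filter fun j => block e s j ∉ T).card} ≤
      2 * Real.exp (-(θ * Real.log 2 / 2)) ^ N := by
  have h := iidProb_lt_card_bad_blocks_mul_le q e T ⌊θ * N⌋₊
  change iidProb q n {s | ⌊θ * N⌋₊ < (Finset.univ.filter fun j => block e s j ∉ T).card} *
    2 ^ ⌊θ * N⌋₊ ≤ _ at h
  -- Rounding `θ * N` down costs at most a factor two.
  have h2 : Real.exp (θ * N * Real.log 2) ≤ 2 * 2 ^ ⌊θ * N⌋₊ := by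
    have : (2 : ℝ) * 2 ^ ⌊θ * N⌋₊ = Real.exp ((⌊θ * N⌋₊ + 1 : ℕ) * Real.log 2) := by
      rw [Real.exp_nat_mul, Real.exp_log two_pos, pow_succ']
    rw [this, Real.exp_le_exp]
    have hlt : θ * N < ⌊θ * N⌋₊ + 1 := Nat.lt_floor_add_one _
    push_cast
    have := Real.log_pos one_lt_two
    gcongr
  have h3 : Real.exp (iidProb q b {z | z ∉ T}) ^ N ≤ Real.exp (θ * Real.log 2 / 2) ^ N := by
    gcongr
  have h4 : Real.exp (θ * Real.log 2 / 2) ^ N =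
      Real.exp (-(θ * Real.log 2 / 2)) ^ N * Real.exp (θ * N * Real.log 2) := by
    rw [← Real.exp_nat_mul, ← Real.exp_nat_mul, ← Real.exp_add]
    congr 1
    ring
  have hE : 0 < Real.exp (-(θ * Real.log 2 / 2)) ^ N := by positivity
  have hpow : (0 : ℝ) < 2 ^ ⌊θ * N⌋₊ := by positivity
  refine le_of_mul_le_mul_right ?_ hpow
  nlinarith [mul_le_mul_of_nonneg_left h2 hE.le]

/-- Compression of a memoryless source at any rate above the entropy, with a bounded number of
probes per symbol and vanishing error probability. -/
theorem exists_localSourceCode {A : Type*} [Fintype A] (q : PMF A) {ε : ℝ} (hε : 0 < ε) :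
    ∃ (d : ℕ) (η : ℕ → ℝ), Tendsto η atTop (𝓝 0) ∧ ∀ᶠ n : ℕ in atTop, ∃ c : LocalSourceCode A n,
      (c.len : ℝ) ≤ n * (shannonEntropy q + ε) ∧
      (∀ i, (c.probe i).Nonempty ∧ (c.probe i).card ≤ d) ∧
      iidProb q n {s | ∃ i, c.dec i (c.enc s) ≠ s i} ≤ η n := by
  classical
  obtain ⟨a₀, -⟩ := q.support_nonempty
  have : Nonempty A := ⟨a₀⟩
  set H := shannonEntropy q with hH
  have hH0 : 0 ≤ H := shannonEntropy_nonneg q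
  have hlog : 0 < Real.log 2 := Real.log_pos one_lt_two
  -- One third of `ε` pays for the table, one for typicality, and one for rounding the index length,
  -- whence `3 / ε ≤ b`. Half of the capacity `δ * n` serves bad blocks and half the fewer than `b`
  -- leftover symbols. As `b` does not depend on `n`, neither does the probe bound.
  obtain ⟨δ, hδ, hexp⟩ := eventually_exists_expander A (γ := ε / 3) (by positivity)
  obtain ⟨b, ⟨T, hTcard, hT⟩, hbε, hb0⟩ := ((eventually_exists_typical q (R := H + ε / 3)
    (η := δ / 2 * Real.log 2 / 2) (by linarith) (by positivity)).and
    ((tendsto_natCast_atTop_atTop.eventually_ge_atTop (3 / ε)).and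
      (eventually_gt_atTop 0))).exists
  rw [div_le_iff₀ hε] at hbε
  set k := ⌈b * (H + ε / 3)⌉₊ with hk
  have hkR : (k : ℝ) ≤ b * (H + 2 * ε / 3) := by
    have : (k : ℝ) < b * (H + ε / 3) + 1 := Nat.ceil_lt_add_one (by positivity)
    linarith
  have hTk : T.card ≤ 2 ^ k := by
    have : (T.card : ℝ) ≤ 2 ^ k := by
      refine hTcard.trans ?_
      rw [← Real.rpow_natCast]
      exact Real.rpow_le_rpow_of_exponent_le one_le_two (Nat.le_ceil _)
    exact_mod_cast this
  have hlim : Tendsto (fun n : ℕ => 2 * Real.exp (-(δ / 2 * Real.log 2 / 2)) ^ (n / b))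
      atTop (𝓝 0) := by
    have h1 : Tendsto (fun N : ℕ => 2 * Real.exp (-(δ / 2 * Real.log 2 / 2)) ^ N)
        atTop (𝓝 (2 * 0)) :=
      (tendsto_pow_atTop_nhds_zero_of_lt_one (Real.exp_pos _).le
        (Real.exp_lt_one_iff.2 (by rw [neg_lt_zero]; positivity))).const_mul 2
    rw [mul_zero] at h1
    exact h1.comp (Nat.tendsto_div_const_atTop hb0.ne')
  refine ⟨k + 8 * Fintype.card A, _, hlim, ?_⟩
  filter_upwards [hexp, tendsto_natCast_atTop_atTop.eventually_ge_atTop (2 * b / δ)] with n hn hnb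
  obtain ⟨Γ, hΓ⟩ := hn
  rw [div_le_iff₀ hδ] at hnb
  have hcard : Fintype.card (Fin n) = Fintype.card ((Fin (n / b) × Fin b) ⊕ Fin (n % b)) := by
    simp only [Fintype.card_fin, Fintype.card_sum, Fintype.card_prod]
    exact (Nat.div_add_mod' n b).symm
  let e := Fintype.equivOfCardEq hcard
  have hNb : ((n / b : ℕ) : ℝ) * b ≤ n := by exact_mod_cast Nat.div_mul_le_self n b
  obtain ⟨c, hlen, hprobe, hdec⟩ := exists_blockCode e T hTk hΓ
  refine ⟨c, ?_, hprobe, ?_⟩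
  · rw [hlen]
    push_cast
    have h1 : ((n / b : ℕ) : ℝ) * k ≤ n * (H + 2 * ε / 3) := by
      calc ((n / b : ℕ) : ℝ) * k ≤ (n / b : ℕ) * (b * (H + 2 * ε / 3)) := by gcongr
        _ = ((n / b : ℕ) * b) * (H + 2 * ε / 3) := by ring
        _ ≤ _ := by gcongr
    have h2 : (⌊ε / 3 * n⌋₊ : ℝ) ≤ ε / 3 * n := Nat.floor_le (by positivity)
    linarith
  · refine (iidProb_mono_of_pos q fun s hs _ => ?_).trans
      (iidProb_lt_card_bad_blocks_le q e T hT)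
    obtain ⟨i, hi⟩ := hs
    by_contra hle
    refine hi (hdec s (Nat.le_floor ?_) i)
    have hle' : (Finset.univ.filter fun j => block e s j ∉ T).card ≤ ⌊δ / 2 * (n / b : ℕ)⌋₊ :=
      not_lt.1 hle
    have h1 : ((Finset.univ.filter fun j => block e s j ∉ T).card : ℝ) ≤ δ / 2 * (n / b : ℕ) :=
      (Nat.cast_le.2 hle').trans (Nat.floor_le (by positivity))
    have h2 : ((n % b : ℕ) : ℝ) ≤ b := by exact_mod_cast (Nat.mod_lt n hb0).le
    push_cast
    calc ((Finset.univ.filter fun j => block e s j ∉ T).card : ℝ) * b + (n % b : ℕ)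
        ≤ δ / 2 * (n / b : ℕ) * b + b := by gcongr
      _ = δ / 2 * (((n / b : ℕ) : ℝ) * b) + b := by ring
      _ ≤ δ / 2 * n + b := by gcongr
      _ ≤ δ * n := by linarith

/-! ### Merging two letters lowers the entropy -/

lemma Real.negMulLog_add_lt {x y : ℝ} (hx : 0 < x) (hy : 0 < y) :
    Real.negMulLog (x + y) < Real.negMulLog x + Real.negMulLog y := by
  have h1 : Real.log x < Real.log (x + y) := Real.log_lt_log hx (by linarith)
  have h2 : Real.log y < Real.log (x + y) := Real.log_lt_log hy (by linarith)
  simp only [Real.negMulLog]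
  nlinarith [mul_lt_mul_of_pos_left h1 hx, mul_lt_mul_of_pos_left h2 hy]

/-- Identifying two letters of positive probability strictly decreases the entropy. -/
lemma shannonEntropy_map_update_lt {A : Type*} [Fintype A] [DecidableEq A] (P : PMF A) {x₁ x₂ : A}
    (hne : x₁ ≠ x₂) (h1 : 0 < P x₁) (h2 : 0 < P x₂) :
    shannonEntropy (P.map (Function.update id x₁ x₂)) < shannonEntropy P := by
  have hlog : 0 < Real.log 2 := Real.log_pos one_lt_two
  have hmem : x₂ ∈ Finset.univ.erase x₁ := by simp [hne.symm]
  have hfib : ∀ a, Function.update id x₁ x₂ a = if a = x₁ then x₂ else a := fun a => by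
    simp [Function.update_apply]
  have hq1 : ((P.map (Function.update id x₁ x₂)) x₁).toReal = 0 := by
    rw [PMF.map_apply_toReal]
    refine Finset.sum_eq_zero fun a ha => ?_
    have ha' := (Finset.mem_filter.1 ha).2
    rw [hfib] at ha'
    split_ifs at ha' with h
    · exact absurd ha'.symm hne
    · exact absurd ha' h
  have hq2 : ((P.map (Function.update id x₁ x₂)) x₂).toReal = (P x₁).toReal + (P x₂).toReal := by
    rw [PMF.map_apply_toReal, ← Finset.sum_pair (f := fun a => (P a).toReal) hne]
    refine Finset.sum_congr ?_ fun _ _ => rfl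
    ext a
    simp only [Finset.mem_filter, Finset.mem_univ, true_and, Finset.mem_insert,
      Finset.mem_singleton, hfib]
    split_ifs with h <;> simp [h]
  have hq : ∀ y, y ≠ x₁ → y ≠ x₂ →
      ((P.map (Function.update id x₁ x₂)) y).toReal = (P y).toReal := fun y hy1 hy2 => by
    rw [PMF.map_apply_toReal, ← Finset.sum_singleton (fun a => (P a).toReal) y]
    refine Finset.sum_congr ?_ fun _ _ => rfl
    ext a
    simp only [Finset.mem_filter, Finset.mem_univ, true_and, Finset.mem_singleton, hfib]
    split_ifs with h
    · subst h
      simp [hy2.symm, hy1.symm]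
    · rfl
  unfold shannonEntropy
  rw [← Finset.add_sum_erase _ _ (Finset.mem_univ x₁), ← Finset.add_sum_erase _ _ hmem,
    ← Finset.add_sum_erase _ (fun a => Real.negMulLog (P a).toReal / Real.log 2)
      (Finset.mem_univ x₁),
    ← Finset.add_sum_erase _ (fun a => Real.negMulLog (P a).toReal / Real.log 2) hmem,
    hq1, hq2, ← add_assoc, ← add_assoc]
  refine add_lt_add_of_lt_of_le ?_ (Finset.sum_le_sum fun a ha => ?_)
  · rw [Real.negMulLog_zero, zero_div, zero_add, ← add_div]
    exact div_lt_div_of_pos_right (Real.negMulLog_add_lt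
      (ENNReal.toReal_pos h1.ne' (P.apply_ne_top _))
      (ENNReal.toReal_pos h2.ne' (P.apply_ne_top _))) hlog
  · simp only [Finset.mem_erase, Finset.mem_univ, and_true] at ha
    rw [hq a ha.2 ha.1]

/-! ### Combining the two codes -/

namespace LocalSourceCode

variable {X Y A : Type*} {n : ℕ}

/-- Separate compression of a function of the first source and of the second source. -/
def combine (c₁ : LocalSourceCode A n) (c₂ : LocalSourceCode Y n) (f : X → A) (g : A → Y → X) :
    LocalCode X Y n where
  len₁ := c₁.len
  len₂ := c₂.len
  enc₁ u := c₁.enc fun t => f (u t)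
  enc₂ := c₂.enc
  probe₁ := c₁.probe
  probe₂ := c₂.probe
  dec i o₁ o₂ :=
    let y := c₂.dec i fun x => if h : x ∈ c₂.probe i then o₂ ⟨x, h⟩ else false
    (g (c₁.dec i fun x => if h : x ∈ c₁.probe i then o₁ ⟨x, h⟩ else false) y, y)

lemma estimate_combine (c₁ : LocalSourceCode A n) (c₂ : LocalSourceCode Y n) (f : X → A)
    (g : A → Y → X) (i : Fin n) (s : Fin n → X × Y) :
    (combine c₁ c₂ f g).estimate i s =
      (g (c₁.dec i (c₁.enc fun t => f (s t).1)) (c₂.dec i (c₂.enc fun t => (s t).2)),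
        c₂.dec i (c₂.enc fun t => (s t).2)) := by
  simp only [LocalCode.estimate, combine]
  rw [c₁.dec_congr i _ (c₁.enc fun t => f (s t).1) fun x hx => dif_pos hx,
    c₂.dec_congr i _ (c₂.enc fun t => (s t).2) fun x hx => dif_pos hx]

/-- On the support, a wrong pair at any position forces an error somewhere in one of the two
component codes, so the union bound applies to every position at once. -/
lemma localError_combine_le [Fintype X] [Fintype Y] [Fintype A] (p : PMF (X × Y))
    (c₁ : LocalSourceCode A n) (c₂ : LocalSourceCode Y n) {f : X → A} {g : A → Y → X}
    (hg : ∀ x y, 0 < p (x, y) → g (f x) y = x) :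
    (combine c₁ c₂ f g).localError p ≤
      iidProb ((p.map Prod.fst).map f) n {s | ∃ i, c₁.dec i (c₁.enc s) ≠ s i} +
      iidProb (p.map Prod.snd) n {s | ∃ i, c₂.dec i (c₂.enc s) ≠ s i} := by
  refine Real.iSup_le (fun i => ?_) (add_nonneg (iidProb_nonneg _ _) (iidProb_nonneg _ _))
  rw [PMF.map_comp, iidProb_map, iidProb_map]
  refine le_trans (iidProb_mono_of_pos p fun s hs hpos => ?_) (iidProb_union_le p _ _)
  by_contra hnot
  obtain ⟨h1, h2⟩ := not_or.1 hnot
  have h1' : ∀ j, c₁.dec j (c₁.enc fun t => f (s t).1) = f (s j).1 := by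
    simpa using h1
  have h2' : ∀ j, c₂.dec j (c₂.enc fun t => (s t).2) = (s j).2 := by
    simpa using h2
  refine hs ?_
  rw [estimate_combine, h1', h2', hg _ _ (hpos i)]

end LocalSourceCode

/-- If `X` is a function of `f X` and `Y`, then it suffices to compress `f X` and `Y`. -/
theorem stronglyLocallyAchievable_of_recoverable {X Y A : Type*} [Fintype X] [Fintype Y]
    [Fintype A] (p : PMF (X × Y)) {f : X → A} {g : A → Y → X}
    (hg : ∀ x y, 0 < p (x, y) → g (f x) y = x) :
    StronglyLocallyAchievable p (shannonEntropy ((p.map Prod.fst).map f))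
      (shannonEntropy (p.map Prod.snd)) := by
  intro ε hε
  obtain ⟨d₁, η₁, hη₁, hc₁⟩ := exists_localSourceCode ((p.map Prod.fst).map f) hε
  obtain ⟨d₂, η₂, hη₂, hc₂⟩ := exists_localSourceCode (p.map Prod.snd) hε
  let Good (n : ℕ) (C : LocalCode X Y n) : Prop :=
    (C.len₁ : ℝ) ≤ n * (shannonEntropy ((p.map Prod.fst).map f) + ε) ∧
      (C.len₂ : ℝ) ≤ n * (shannonEntropy (p.map Prod.snd) + ε) ∧
      C.localError p ≤ η₁ n + η₂ n ∧
      (∀ i, 1 ≤ (C.probe₁ i).card) ∧ C.locality ≤ d₁ + d₂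
  have hgood : ∀ᶠ n in atTop, ∃ C, Good n C := by
    filter_upwards [hc₁, hc₂] with n h₁ h₂
    obtain ⟨c₁, hl₁, hp₁, he₁⟩ := h₁
    obtain ⟨c₂, hl₂, hp₂, he₂⟩ := h₂
    exact ⟨c₁.combine c₂ f g, hl₁, hl₂,
      (LocalSourceCode.localError_combine_le p c₁ c₂ hg).trans (add_le_add he₁ he₂),
      fun i => Finset.card_pos.2 (hp₁ i).1,
      Finset.sup_le fun i _ => add_le_add (hp₁ i).2 (hp₂ i).2⟩
  obtain ⟨z, -⟩ := p.support_nonempty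
  -- Good codes exist only for large `n`; a trivial code of length zero fills the other
  -- blocklengths.
  have hchoice : ∀ n, ∃ C : LocalCode X Y n, (∃ C', Good n C') → Good n C := fun n => by
    have : Nonempty (LocalCode X Y n) := ⟨⟨0, 0, fun _ _ => false, fun _ _ => false, fun _ => ∅,
      fun _ => ∅, fun _ _ _ => z⟩⟩
    by_cases h : ∃ C', Good n C'
    · exact h.imp fun _ hC' _ => hC'
    · exact ⟨Classical.arbitrary _, fun h' => absurd h' h⟩
  choose C hC using hchoice
  have hev : ∀ᶠ n in atTop, Good n (C n) := hgood.mono hC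
  refine ⟨C, hev.mono fun n hn => hn.1, hev.mono fun n hn => hn.2.1, ?_, ?_, ?_⟩
  · refine squeeze_zero' (Eventually.of_forall fun n => Real.iSup_nonneg fun i =>
      iidProb_nonneg p _) (hev.mono fun n hn => hn.2.2.1) ?_
    simpa using hη₁.add hη₂
  · refine IsBigO.of_bound ((d₁ + d₂ : ℕ) : ℝ) (hev.mono fun n hn => ?_)
    simpa using (Nat.cast_le (α := ℝ)).2 hn.2.2.2.2
  -- The lower half of `Θ(1)` uses that at least one component is always probed, and that some
  -- position exists.
  · refine IsBigO.of_bound 1 ((hev.and (eventually_gt_atTop 0)).mono fun n hn => ?_)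
    have h1 : 1 ≤ (C n).locality :=
      (hn.1.2.2.2.1 ⟨0, hn.2⟩).trans ((Nat.le_add_right _ _).trans
        (Finset.le_sup (f := fun i => ((C n).probe₁ i).card + ((C n).probe₂ i).card)
          (Finset.mem_univ (⟨0, hn.2⟩ : Fin n))))
    simpa using h1

theorem theorem3 {X Y : Type*} [Fintype X] [Fintype Y] (p : PMF (X × Y))
    (hX : ∀ x, 0 < (p.map Prod.fst) x) (hY : ∀ y, 0 < (p.map Prod.snd) y)
    (hp : ¬ XConfusable p) :
    ∃ R₁ : ℝ, R₁ < shannonEntropy (p.map Prod.fst) ∧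
      StronglyLocallyAchievable p R₁ (shannonEntropy (p.map Prod.snd)) := by
  classical
  simp only [XConfusable, not_forall, not_exists] at hp
  obtain ⟨x₁, x₂, hdisj⟩ := hp
  -- A letter of positive marginal mass is compatible with some `y`, hence confusable with itself.
  have hne : x₁ ≠ x₂ := by
    rintro rfl
    obtain ⟨z, hz, hzx⟩ := (PMF.mem_support_map_iff _ _ _).1 ((PMF.mem_support_iff _ _).2 (hX x₁).ne')
    have hz' : 0 < p z := pos_iff_ne_zero.2 ((PMF.mem_support_iff _ _).1 hz)
    refine hdisj z.2 ?_
    rw [← hzx]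
    exact ⟨hz', hz'⟩
  -- The letter `x₁` is merged into `x₂`; when `x₂` is read, `y` tells them apart, since it is
  -- possible with at most one of the two.
  refine ⟨_, shannonEntropy_map_update_lt (p.map Prod.fst) hne (hX x₁) (hX x₂),
    stronglyLocallyAchievable_of_recoverable p
      (g := fun a y => if a = x₂ ∧ 0 < p (x₁, y) then x₁ else a) fun x y hxy => ?_⟩
  by_cases h1 : x = x₁
  · subst h1
    simp [hxy]
  · simp only [Function.update_of_ne h1, id_eq]
    refine if_neg ?_
    rintro ⟨rfl, h⟩
    exact hdisj y ⟨h, hxy⟩
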